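/- Let $k$ be a field, let $S = k[x_1,\dots,x_n]$ be the standard graded polynomial ring, and let $f_1,\dots,f_m \in S$ be homogeneous polynomials forming a regular sequence (in particular $(f_1,\dots,f_m)\neq S$; $m=0$ is allowed). Let $K(f_1,\dots,f_m)$ be the Koszul complex: $K_d$ is the free $S$-module with basis $e_T$, $T$ ranging over the $d$-element subsets of $\{1,\dots,m\}$, and for $T=\{i_1<\dots<i_d\}$ the differential is $\partial e_T=\sum_{j=1}^d(-1)^j f_{i_j}e_{T\setminus\{i_j\}}$. For a complex $G=(\cdots\to G_1\to G_0)$ of free $S$-modules, a subcomplex of $G$ is a complex $F$ of free $S$-modules for which there are split injective $S$-linear maps $\varphi_i:F_i\to G_i$ commuting with the differentials. Let $RS(G)$ be the set of all rank sequences $(\operatorname{rank}F_0,\operatorname{rank}F_1,\dots)$ of subcomplexes $F$ of $G$. For integers $a\ge 1$ and $i\ge 1$ write the Macaulay expansion $a=\binom{a_i}{i}+\binom{a_{i-1}}{i-1}+\dots+\binom{a_j}{j}$ with $a_i>a_{i-1}>\dots>a_j\ge j\ge 1$, which exists and is unique, and put $a^{(i)}=\binom{a_i}{i+1}+\binom{a_{i-1}}{i}+\dots+\binom{a_j}{j+1}$;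 put $0^{(i)}=0$. Let $r=(r_0,\dots,r_m)$ be a sequence of non-negative integers, extended by $r_i=0$ for $i>m$. Then $r\in RS(K(f_1,\dots,f_m))$ if and only if either $r$ is the zero sequence, or $r_0=1$, $r_1\le m$, and $0\le r_{i+1}\le r_i^{(i)}$ for all $1\le i\le m-1$. -/

import Mathlib

open CategoryTheory

universe u

/-! ### The Koszul complex -/

/-- The subsets of size `d` of `{0, …, m - 1}`: they index the basis of the `d`-th term of the
Koszul complex on `m` elements. -/
abbrev KoszulIndex (m d : ℕ) : Type := {T : Finset (Fin m) // T.card = d}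

namespace KoszulIndex

/-- The set `T` with its element `i` removed. -/
def erase {m d : ℕ} (T : KoszulIndex m (d + 1)) (i : {i // i ∈ T.1}) : KoszulIndex m d :=
  ⟨T.1.erase i.1, by rw [Finset.card_erase_of_mem i.2, T.2]; rfl⟩

end KoszulIndex

/-- If `T = {i₁ < i₂ < ⋯ < i_d}` and `i = i_j`, this is the position `j` (counted from `1`). -/
def koszulPos {m : ℕ} (T : Finset (Fin m)) (i : Fin m) : ℕ := (T.filter (· ≤ i)).card

lemma koszulPos_erase_of_lt {m : ℕ} {T : Finset (Fin m)} {i j : Fin m} (hij : i < j) :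
    koszulPos (T.erase j) i = koszulPos T i := by
  unfold koszulPos
  congr 1
  ext t
  simp only [Finset.mem_filter, Finset.mem_erase]
  constructor
  · rintro ⟨⟨_, h⟩, h'⟩
    exact ⟨h, h'⟩
  · rintro ⟨h, h'⟩
    exact ⟨⟨(lt_of_le_of_lt h' hij).ne, h⟩, h'⟩

lemma koszulPos_erase_of_gt {m : ℕ} {T : Finset (Fin m)} {i j : Fin m} (hi : i ∈ T)
    (hij : i < j) : koszulPos (T.erase i) j + 1 = koszulPos T j := by
  unfold koszulPos
  rw [Finset.filter_erase]
  exact Finset.card_erase_add_one (Finset.mem_filter.2 ⟨hi, hij.le⟩)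

/-- The Koszul differential on the free module with basis `e_T`, `T` of size `d + 1`:
`∂ e_T = ∑_j (-1)^j f_{i_j} e_{T \ i_j}` for `T = {i₁ < ⋯ < i_{d+1}}`. -/
noncomputable def koszulDiff {R : Type u} [CommRing R] {m : ℕ} (f : Fin m → R) (d : ℕ) :
    (KoszulIndex m (d + 1) →₀ R) →ₗ[R] (KoszulIndex m d →₀ R) :=
  Finsupp.linearCombination R fun T : KoszulIndex m (d + 1) =>
    ∑ i : {i // i ∈ T.1}, Finsupp.single (T.erase i) ((-1) ^ koszulPos T.1 i.1 * f i.1)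

lemma koszulDiff_comp {R : Type u} [CommRing R] {m : ℕ} (f : Fin m → R) (d : ℕ) :
    koszulDiff f d ∘ₗ koszulDiff f (d + 1) = 0 := by
  apply Finsupp.lhom_ext'
  intro T
  apply LinearMap.ext_ring
  simp only [koszulDiff, LinearMap.comp_apply, Finsupp.lsingle_apply,
    Finsupp.linearCombination_single, one_smul, map_sum, LinearMap.zero_apply,
    Finset.smul_sum, Finsupp.smul_single, smul_eq_mul]
  rw [Finset.sum_sigma']
  refine Finset.sum_involution
    (fun x _ => ⟨⟨x.2.1, Finset.mem_of_mem_erase x.2.2⟩,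
      ⟨x.1.1, Finset.mem_erase.2 ⟨(Finset.ne_of_mem_erase x.2.2).symm, x.1.2⟩⟩⟩)
    ?_ ?_ ?_ ?_
  · rintro ⟨⟨i, hi⟩, ⟨j, hj⟩⟩ -
    have hji : j ≠ i := Finset.ne_of_mem_erase hj
    have hjT : j ∈ T.1 := Finset.mem_of_mem_erase hj
    have key : (T.erase ⟨i, hi⟩).erase ⟨j, hj⟩ =
        (T.erase ⟨j, hjT⟩).erase ⟨i, Finset.mem_erase.2 ⟨hji.symm, hi⟩⟩ :=
      Subtype.ext (Finset.erase_right_comm)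
    dsimp only
    rw [key, ← Finsupp.single_add]
    refine (congrArg (Finsupp.single _) ?_).trans (Finsupp.single_zero _)
    change (-1) ^ koszulPos T.1 i * f i * ((-1) ^ koszulPos (T.1.erase i) j * f j) +
      (-1) ^ koszulPos T.1 j * f j * ((-1) ^ koszulPos (T.1.erase j) i * f i) = 0
    rcases lt_or_gt_of_ne hji with h | h
    · rw [koszulPos_erase_of_lt h, ← koszulPos_erase_of_gt hjT h, pow_succ]
      ring
    · rw [koszulPos_erase_of_lt h, ← koszulPos_erase_of_gt hi h, pow_succ]
      ring
  · rintro ⟨⟨i, hi⟩, ⟨j, hj⟩⟩ - - h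
    exact Finset.ne_of_mem_erase hj (congrArg (fun x => (x.1 : Fin m)) h)
  · intro _ _
    simp
  · intro _ _
    rfl

/-- The Koszul complex `K(f₁, …, f_m)` over a commutative ring `R`: in degree `d` the free module
whose basis is indexed by the subsets of size `d` of the index set. -/
noncomputable def koszulComplex {R : Type u} [CommRing R] {m : ℕ} (f : Fin m → R) :
    ChainComplex (ModuleCat.{u} R) ℕ :=
  ChainComplex.of (fun d => ModuleCat.of R (KoszulIndex m d →₀ R))
    (fun d => ModuleCat.ofHom (koszulDiff f d))
    (fun d => by rw [← ModuleCat.ofHom_comp, koszulDiff_comp]; rfl)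

/-! ### Subcomplexes and rank sequences -/

/-- `F` is a subcomplex of `G`: there is a map of complexes `φ : F ⟶ G` all of whose components
are split injective. -/
def IsSubcomplex {R : Type u} [CommRing R] (F G : ChainComplex (ModuleCat.{u} R) ℕ) : Prop :=
  ∃ φ : F ⟶ G, ∀ i, ∃ ψ : G.X i →ₗ[R] F.X i, ψ ∘ₗ (φ.f i).hom = LinearMap.id

/-- A complex of free modules has rank sequence `r = (r₀, r₁, …)`: its `i`-th term is free of
(finite) rank `r i`. -/
def HasRankSequence {R : Type u} [CommRing R] (F : ChainComplex (ModuleCat.{u} R) ℕ)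
    (r : ℕ → ℕ) : Prop :=
  ∀ i, Module.Free R (F.X i) ∧ Module.rank R (F.X i) = (r i : Cardinal)

/-- `RS(G)`: the set of the rank sequences of the free subcomplexes of `G`. -/
def rankSequences {R : Type u} [CommRing R] (G : ChainComplex (ModuleCat.{u} R) ℕ) :
    Set (ℕ → ℕ) :=
  {r | ∃ F : ChainComplex (ModuleCat.{u} R) ℕ, IsSubcomplex F G ∧ HasRankSequence F r}

/-! ### Macaulay expansions -/

/-- `a = C(c i, i) + C(c (i-1), i-1) + ⋯ + C(c j, j)` with
`c i > c (i-1) > ⋯ > c j ≥ j ≥ 1`. -/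
structure IsMacaulayExpansion (a i j : ℕ) (c : ℕ → ℕ) : Prop where
  one_le : 1 ≤ j
  le : j ≤ i
  le_last : j ≤ c j
  strictMonoOn : StrictMonoOn c (Set.Icc j i)
  eq_sum : a = ∑ l ∈ Finset.Icc j i, (c l).choose l

open Classical in
/-- The shifted Macaulay expansion
`a^{(i)} = C(c i, i+1) + C(c (i-1), i) + ⋯ + C(c j, j+1)`, where
`a = C(c i, i) + ⋯ + C(c j, j)` is the Macaulay expansion of `a ≥ 1`; and `0^{(i)} = 0`. -/
noncomputable def macaulayShift (a i : ℕ) : ℕ :=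
  if h : ∃ p : ℕ × (ℕ → ℕ), IsMacaulayExpansion a i p.1 p.2 then
    ∑ l ∈ Finset.Icc h.choose.1 i, (h.choose.2 l).choose (l + 1)
  else 0

/-- The number `0` has no Macaulay expansion, and its shifted expansion is the empty sum. -/
lemma macaulayShift_zero (i : ℕ) : macaulayShift 0 i = 0 := by
  unfold macaulayShift
  rw [dif_neg]
  rintro ⟨⟨j, c⟩, h⟩
  have h1 := (Finset.sum_eq_zero_iff.1 h.eq_sum.symm) j (Finset.mem_Icc.2 ⟨le_rfl, h.le⟩)
  have h2 := Nat.choose_pos h.le_last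
  dsimp only at h1 h2
  omega

namespace IsMacaulayExpansion

lemma pos {a i j : ℕ} {c : ℕ → ℕ} (h : IsMacaulayExpansion a i j c) : 0 < a := by
  rw [h.eq_sum]
  exact lt_of_lt_of_le (Nat.choose_pos h.le_last)
    (Finset.single_le_sum (f := fun l => (c l).choose l) (fun _ _ => Nat.zero_le _)
      (Finset.mem_Icc.2 ⟨le_rfl, h.le⟩))

/-- Removing the top term. -/
lemma tail {a i j : ℕ} {c : ℕ → ℕ} (h : IsMacaulayExpansion a (i + 1) j c) (hj : j ≤ i) :
    IsMacaulayExpansion (∑ l ∈ Finset.Icc j i, (c l).choose l) i j c :=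
  ⟨h.one_le, hj, h.le_last,
    h.strictMonoOn.mono (Set.Icc_subset_Icc_right (Nat.le_succ i)), rfl⟩

lemma lt_choose {i : ℕ} : ∀ {a j : ℕ} {c : ℕ → ℕ}, IsMacaulayExpansion a i j c →
    a < (c i + 1).choose i := by
  induction i with
  | zero =>
    intro a j c h
    have := h.one_le
    have := h.le
    omega
  | succ i ih =>
    intro a j c h
    rw [Nat.choose_succ_succ']
    rcases Nat.lt_or_ge i j with hj | hj
    · have hji : j = i + 1 := le_antisymm h.le hj
      subst hji
      have h1 := h.eq_sum
      rw [Finset.Icc_self, Finset.sum_singleton] at h1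
      have h2 := Nat.choose_pos (le_trans (Nat.le_succ i) h.le_last)
      omega
    · have h1 := h.eq_sum
      rw [Finset.sum_Icc_succ_top (by omega)] at h1
      have h2 := ih (h.tail hj)
      have h3 : c i < c (i + 1) := h.strictMonoOn ⟨hj, by omega⟩ ⟨by omega, le_rfl⟩ (by omega)
      have h4 : (c i + 1).choose i ≤ (c (i + 1)).choose i := Nat.choose_le_choose i h3
      omega

lemma choose_le {a i j : ℕ} {c : ℕ → ℕ} (h : IsMacaulayExpansion a i j c) :
    (c i).choose i ≤ a := by
  rw [h.eq_sum]
  exact Finset.single_le_sum (f := fun l => (c l).choose l) (fun _ _ => Nat.zero_le _)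
      (Finset.mem_Icc.2 ⟨h.le, le_rfl⟩)

/-- The Macaulay expansion is unique. -/
lemma unique {i : ℕ} : ∀ {a j j' : ℕ} {c c' : ℕ → ℕ}, IsMacaulayExpansion a i j c →
    IsMacaulayExpansion a i j' c' → j = j' ∧ ∀ l ∈ Finset.Icc j i, c l = c' l := by
  induction i with
  | zero =>
    intro a j j' c c' h
    have := h.one_le
    have := h.le
    omega
  | succ i ih =>
    intro a j j' c c' h h'
    have htop : c (i + 1) = c' (i + 1) := by
      have h1 := h.lt_choose
      have h2 := h.choose_le
      have h3 := h'.lt_choose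
      have h4 := h'.choose_le
      rcases lt_trichotomy (c (i + 1)) (c' (i + 1)) with hlt | heq | hlt
      · have := Nat.choose_le_choose (i + 1) (Nat.succ_le_of_lt hlt)
        simp only [Nat.succ_eq_add_one] at this
        omega
      · exact heq
      · have := Nat.choose_le_choose (i + 1) (Nat.succ_le_of_lt hlt)
        simp only [Nat.succ_eq_add_one] at this
        omega
    have hs := h.eq_sum
    have hs' := h'.eq_sum
    rw [Finset.sum_Icc_succ_top (by have := h.le; omega)] at hs
    rw [Finset.sum_Icc_succ_top (by have := h'.le; omega), ← htop] at hs'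
    rcases Nat.lt_or_ge i j with hj | hj <;> rcases Nat.lt_or_ge i j' with hj' | hj'
    · have e1 : j = i + 1 := le_antisymm h.le hj
      have e2 : j' = i + 1 := le_antisymm h'.le hj'
      refine ⟨by omega, fun l hl => ?_⟩
      rw [Finset.mem_Icc] at hl
      obtain rfl : l = i + 1 := by omega
      exact htop
    · have := (h'.tail hj').pos
      rw [Finset.Icc_eq_empty (by omega), Finset.sum_empty] at hs
      omega
    · have := (h.tail hj).pos
      rw [Finset.Icc_eq_empty (by omega : ¬ j' ≤ i), Finset.sum_empty] at hs'
      omega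
    · have t := h.tail hj
      have t' := h'.tail hj'
      have e : ∑ l ∈ Finset.Icc j i, (c l).choose l = ∑ l ∈ Finset.Icc j' i, (c' l).choose l := by
        omega
      rw [e] at t
      obtain ⟨e1, e2⟩ := ih t t'
      refine ⟨e1, fun l hl => ?_⟩
      rw [Finset.mem_Icc] at hl
      rcases Nat.lt_or_ge i l with hl' | hl'
      · obtain rfl : l = i + 1 := by omega
        exact htop
      · exact e2 l (Finset.mem_Icc.2 ⟨hl.1, hl'⟩)

/-- Every positive integer has a Macaulay expansion of every level `i ≥ 1`. -/
lemma exists_of_pos {i : ℕ} (hi : 1 ≤ i) : ∀ {a : ℕ}, 0 < a →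
    ∃ j c, IsMacaulayExpansion a i j c := by
  induction i, hi using Nat.le_induction with
  | base =>
    intro a ha
    refine ⟨1, fun _ => a, le_rfl, le_rfl, ha, ?_, by simp⟩
    rw [Set.Icc_self]
    exact Set.strictMonoOn_singleton _
  | succ i hi ih =>
    intro a ha
    have hbound : ∀ b, (b + (i + 1)).choose (i + 1) ≤ a → b ≤ a := by
      intro b hb
      have h1 : (b + 1).choose b = (b + 1).choose 1 := Nat.choose_symm_add
      have h2 : (b + (i + 1)).choose b = (b + (i + 1)).choose (i + 1) := Nat.choose_symm_add
      have h3 : (b + 1).choose b ≤ (b + (i + 1)).choose b := Nat.choose_le_choose b (by omega)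
      rw [Nat.choose_one_right] at h1
      omega
    let P : ℕ → Prop := fun b => (b + (i + 1)).choose (i + 1) ≤ a
    have hP0 : P 0 := by simp only [P, Nat.zero_add, Nat.choose_self]; omega
    set b := Nat.findGreatest P a with hb
    have hPb : P b := Nat.findGreatest_spec (P := P) (Nat.zero_le a) hP0
    have hnb : ¬ P (b + 1) := by
      intro h
      have h1 := hbound _ h
      have := Nat.le_findGreatest (P := P) h1 h
      omega
    have hlt : a < (b + (i + 1) + 1).choose (i + 1) := by
      have h1 := not_le.1 hnb
      rwa [show b + 1 + (i + 1) = b + (i + 1) + 1 by omega] at h1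
    rw [Nat.choose_succ_succ'] at hlt
    rcases Nat.eq_zero_or_pos (a - (b + (i + 1)).choose (i + 1)) with h0 | h0
    · refine ⟨i + 1, fun _ => b + (i + 1), by omega, le_rfl, by simp, ?_, ?_⟩
      · rw [Set.Icc_self]
        exact Set.strictMonoOn_singleton _
      · rw [Finset.Icc_self, Finset.sum_singleton]
        have : (b + (i + 1)).choose (i + 1) ≤ a := hPb
        omega
    · obtain ⟨j, c, h⟩ := ih h0
      have hci : c i < b + (i + 1) := by
        by_contra hge
        have h1 := Nat.choose_le_choose i (not_lt.1 hge)
        have h2 := h.choose_le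
        have : (b + (i + 1)).choose (i + 1) ≤ a := hPb
        omega
      have hj := h.le
      refine ⟨j, Function.update c (i + 1) (b + (i + 1)), h.one_le, by omega, ?_, ?_, ?_⟩
      · rw [Function.update_of_ne (by omega)]
        exact h.le_last
      · intro x hx y hy hxy
        have hx2 : x ≠ i + 1 := by have := hy.2; omega
        rw [Function.update_of_ne hx2]
        have hxi : x ≤ i := by have := hx.2; omega
        by_cases hyi : y = i + 1
        · subst hyi
          rw [Function.update_self]
          exact lt_of_le_of_lt
            (h.strictMonoOn.monotoneOn ⟨hx.1, hxi⟩ ⟨hj, le_rfl⟩ hxi) hci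
        · rw [Function.update_of_ne hyi]
          exact h.strictMonoOn ⟨hx.1, hxi⟩ ⟨hy.1, by have := hy.2; omega⟩ hxy
      · rw [Finset.sum_Icc_succ_top (by omega), Function.update_self]
        have e : ∑ l ∈ Finset.Icc j i, (Function.update c (i + 1) (b + (i + 1)) l).choose l =
            ∑ l ∈ Finset.Icc j i, (c l).choose l := by
          refine Finset.sum_congr rfl fun l hl => ?_
          rw [Function.update_of_ne (by have := (Finset.mem_Icc.1 hl).2; omega)]
        rw [e, ← h.eq_sum]
        have : (b + (i + 1)).choose (i + 1) ≤ a := hPb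
        omega

/-- The shifted expansion can be computed from any Macaulay expansion. -/
lemma macaulayShift_eq {a i j : ℕ} {c : ℕ → ℕ} (h : IsMacaulayExpansion a i j c) :
    macaulayShift a i = ∑ l ∈ Finset.Icc j i, (c l).choose (l + 1) := by
  have hex : ∃ p : ℕ × (ℕ → ℕ), IsMacaulayExpansion a i p.1 p.2 := ⟨(j, c), h⟩
  unfold macaulayShift
  rw [dif_pos hex]
  obtain ⟨e1, e2⟩ := h.unique hex.choose_spec
  rw [← e1]
  exact Finset.sum_congr rfl fun l hl => by rw [e2 l hl]

end IsMacaulayExpansion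

/-!
A subcomplex `F` of the Koszul complex becomes, modulo a maximal ideal `𝔪` containing all `f i`, a
graded subspace of an exterior algebra, and the differential survives as the family of all
contractions. Indeed `∂ x = ∑ f i • contraction i x`. If `x` lies in `F`, so does `∂ x`, and the
projection onto a complement of `F` turns this into a relation among the `f i`. The relations of a
regular sequence have coefficients in the ideal of the `f i`
(`mem_ofList_of_sum_mul_eq_zero`), so each `contraction i x` lies in `F` modulo `𝔪`
(`contraction_mem_reducedRange`). Being split, `F_d` reduces to a subspace of dimension equal to
its rank (`finrank_reducedRange`).

So the ranks are the dimensions of a graded subspace closed under contractions. Replacing each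
vector by its colexicographically last set replaces that subspace by a simplicial complex with the
same numbers (`ncard_leadingPositions`, `shadow_leadingSets_subset`), to which the Kruskal–Katona
theorem applies. Conversely, the inequalities are those which make the colexicographic initial
segments with `r d` elements into a simplicial complex (`exists_simplicialComplex`), and its faces
span a subcomplex (`faceComplex`).

Mathlib states the Kruskal–Katona theorem for initial segments of the colexicographic order. The
translation into Macaulay expansions (`card_le_macaulayShift`) goes through the combinatorial number
system: the number of sets of its size preceding `{c j < ⋯ < c i}` is a sum of binomial
coefficients, by the recursion `colexRank_insert`.
-/

/-! ### Macaulay expansions and the colexicographic order -/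

section Colex

open Finset Finset.Colex
open scoped FinsetFamily

/-- The rank of a finite set of natural numbers in the colexicographic order of the sets of its
size, counted from `0`. -/
noncomputable def colexRank (s : Finset ℕ) : ℕ :=
  {t : Finset ℕ | #t = #s ∧ toColex t < toColex s}.ncard

lemma finite_colex_le (s : Finset ℕ) : {t : Finset ℕ | toColex t ≤ toColex s}.Finite := by
  refine (Finset.finite_toSet (range (s.sup id + 1)).powerset).subset fun t ht => ?_
  simp only [coe_powerset, Set.mem_preimage, Set.mem_powerset_iff, coe_subset]
  intro x hx
  exact mem_range.2 (forall_lt_mono ht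
    (fun b hb => Nat.lt_succ_of_le (le_sup (f := id) hb)) x hx)

lemma finite_colexRank (s : Finset ℕ) :
    {t : Finset ℕ | #t = #s ∧ toColex t < toColex s}.Finite :=
  (finite_colex_le s).subset fun _ ht => ht.2.le

lemma colexRank_lt {s t : Finset ℕ} (hc : #s = #t) (h : toColex s < toColex t) :
    colexRank s < colexRank t := by
  refine Set.ncard_lt_ncard ?_ (finite_colexRank t)
  refine (Set.ssubset_iff_of_subset fun x hx => ?_).2 ⟨s, ⟨hc, h⟩, fun h' => lt_irrefl _ h'.2⟩
  exact ⟨hx.1.trans hc, hx.2.trans h⟩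

lemma colexRank_lt_iff {s t : Finset ℕ} (hc : #s = #t) :
    colexRank s < colexRank t ↔ toColex s < toColex t := by
  refine ⟨fun h => ?_, colexRank_lt hc⟩
  by_contra h'
  rcases (not_lt.1 h').eq_or_lt with e | e
  · rw [toColex_inj.1 e] at h
    exact lt_irrefl _ h
  · exact lt_asymm h (colexRank_lt hc.symm e)

lemma toColex_lt_insert_iff {s t : Finset ℕ} {a : ℕ} (hs : ∀ x ∈ s, x < a) :
    toColex t < toColex (insert a s) ↔
      (∀ x ∈ t, x < a) ∨ (a ∈ t ∧ toColex (t.erase a) < toColex s) := by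
  have has : a ∉ s := fun h => lt_irrefl _ (hs a h)
  by_cases ha : a ∈ t
  · rw [← toColex_sdiff_lt_toColex_sdiff (u := {a}) (by simpa) (by simp), sdiff_singleton_eq_erase,
      sdiff_singleton_eq_erase, erase_insert has]
    constructor
    · exact fun h => Or.inr ⟨ha, h⟩
    · rintro (h | h)
      · exact absurd (h a ha) (lt_irrefl _)
      · exact h.2
  · constructor
    · refine fun h => Or.inl fun x hx => lt_of_le_of_ne (forall_le_mono h.le ?_ x hx) ?_
      · intro b hb
        rcases mem_insert.1 hb with rfl | hb
        · exact le_rfl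
        · exact (hs b hb).le
      · rintro rfl
        exact ha hx
    · rintro (h | h)
      · exact (toColex_lt_singleton.2 h).trans_le (toColex_le_toColex_of_subset (by simp))
      · exact absurd h.1 ha

/-- The recursion behind the combinatorial number system: a set of size `#s + 1` preceding
`insert a s` either lies below `a`, or contains `a` and precedes `insert a s` within the rest. -/
lemma colexRank_insert {s : Finset ℕ} {a : ℕ} (hs : ∀ x ∈ s, x < a) :
    colexRank (insert a s) = a.choose (#s + 1) + colexRank s := by
  have has : a ∉ s := fun h => lt_irrefl _ (hs a h)
  have ht : ∀ t : Finset ℕ, toColex t < toColex s → a ∉ t := fun t h hat =>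
    lt_irrefl _ (forall_lt_mono h.le hs a hat)
  have key : {t : Finset ℕ | #t = #(insert a s) ∧ toColex t < toColex (insert a s)} =
      (powersetCard (#s + 1) (range a) : Set (Finset ℕ)) ∪
        insert a '' {t : Finset ℕ | #t = #s ∧ toColex t < toColex s} := by
    ext t
    simp only [Set.mem_ofPred_eq, toColex_lt_insert_iff hs, card_insert_of_notMem has, Set.mem_union,
      mem_coe, mem_powersetCard, Set.mem_image]
    constructor
    · rintro ⟨hc, h | ⟨h1, h2⟩⟩
      · exact Or.inl ⟨fun x hx => mem_range.2 (h x hx), hc⟩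
      · exact Or.inr ⟨t.erase a, ⟨by rw [card_erase_of_mem h1, hc]; rfl, h2⟩, insert_erase h1⟩
    · rintro (⟨h, hc⟩ | ⟨t, ⟨hc, h⟩, rfl⟩)
      · exact ⟨hc, Or.inl fun x hx => mem_range.1 (h hx)⟩
      · refine ⟨by rw [card_insert_of_notMem (ht t h), hc], Or.inr ⟨by simp, ?_⟩⟩
        rwa [erase_insert (ht t h)]
  unfold colexRank
  rw [key, Set.ncard_union_eq ?_ (Finset.finite_toSet _) ((finite_colexRank s).image _),
    Set.ncard_coe_finset, card_powersetCard, card_range, Set.InjOn.ncard_image]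
  · intro x hx y hy h
    rw [← erase_insert (ht x hx.2), ← erase_insert (ht y hy.2)]
    exact congrArg (fun z => erase z a) h
  · rw [Set.disjoint_left]
    rintro _ h ⟨t, -, rfl⟩
    have := (mem_powersetCard.1 h).1 (mem_insert_self a t)
    simp at this

/-- The set `{0, …, j - 1}` comes first among the sets of size `j`. -/
lemma not_lt_colex_range {j : ℕ} {t : Finset ℕ} (hc : #t = j) :
    ¬ toColex t < toColex (range j) := by
  intro h
  have h1 : t ⊆ range j := fun x hx =>
    mem_range.2 (forall_lt_mono h.le (fun b hb => mem_range.1 hb) x hx)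
  have h2 : t = range j := eq_of_subset_of_card_le h1 (by simp [hc])
  rw [h2] at h
  exact lt_irrefl _ h

lemma colexRank_range (j : ℕ) : colexRank (range j) = 0 := by
  unfold colexRank
  rw [Set.ncard_eq_zero (finite_colexRank _)]
  ext t
  simp only [card_range, Set.mem_ofPred_eq, Set.mem_empty_iff_false, iff_false, not_and]
  exact fun h => not_lt_colex_range h

/-- The set `{0, …, b - 1} ∪ {c j, …, c (j + n - 1)}`. When `c j < ⋯ < c (j + n - 1)` are the tops
of the Macaulay expansion of `a` at level `i = j + n - 1`, it has, among the sets of its size,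
colexicographic rank `a` for `b = j - 1` and `a^{(i)}` for `b = j`. -/
def cascadeSet (b j n : ℕ) (c : ℕ → ℕ) : Finset ℕ := range b ∪ (Ico j (j + n)).image c

section cascadeSet

variable {b j n : ℕ} {c : ℕ → ℕ}

lemma cascadeSet_zero : cascadeSet b j 0 c = range b := by simp [cascadeSet]

lemma cascadeSet_succ : cascadeSet b j (n + 1) c = insert (c (j + n)) (cascadeSet b j n c) := by
  rw [cascadeSet, cascadeSet, ← add_assoc, ← insert_Ico_right_eq_Ico_add_one (by omega),
    image_insert, union_insert]

/-- The next top exceeds all elements, so a cascade is built by inserting new maxima. -/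
lemma lt_of_mem_cascadeSet (hb : b ≤ j) (hj : j ≤ c j)
    (hc : StrictMonoOn c (Set.Ico j (j + (n + 1)))) : ∀ x ∈ cascadeSet b j n c, x < c (j + n) := by
  intro x hx
  simp only [cascadeSet, mem_union, mem_range, mem_image, mem_Ico] at hx
  rcases hx with h | ⟨l, h, rfl⟩
  · have := hc.monotoneOn (a := j) (b := j + n) ⟨le_rfl, by omega⟩ ⟨by omega, by omega⟩ (by omega)
    omega
  · exact hc ⟨h.1, by omega⟩ ⟨by omega, by omega⟩ h.2

lemma card_cascadeSet (hb : b ≤ j) (hj : j ≤ c j) (hc : StrictMonoOn c (Set.Ico j (j + n))) :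
    #(cascadeSet b j n c) = b + n := by
  induction n with
  | zero => simp [cascadeSet_zero]
  | succ n ih =>
    rw [cascadeSet_succ, card_insert_of_notMem
      (fun h => lt_irrefl _ (lt_of_mem_cascadeSet hb hj hc _ h)),
      ih (hc.mono (Set.Ico_subset_Ico_right (by omega))), add_assoc]

/-- The case `e = 0`, `b = j - 1` gives a Macaulay expansion, the case `e = 1`, `b = j` the shifted
one. -/
lemma colexRank_cascadeSet {e : ℕ} (hb : b ≤ j) (hbe : b + 1 = j + e) (hj : j ≤ c j)
    (hc : StrictMonoOn c (Set.Ico j (j + n))) :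
    colexRank (cascadeSet b j n c) = ∑ l ∈ Ico j (j + n), (c l).choose (l + e) := by
  induction n with
  | zero => simp [cascadeSet_zero, colexRank_range]
  | succ n ih =>
    have hc' := hc.mono (Set.Ico_subset_Ico_right (by omega : j + n ≤ j + (n + 1)))
    rw [cascadeSet_succ, colexRank_insert (lt_of_mem_cascadeSet hb hj hc), ih hc',
      card_cascadeSet hb hj hc', ← add_assoc, ← insert_Ico_right_eq_Ico_add_one (by omega),
      sum_insert (by simp), show b + n + 1 = j + n + e by omega]

/-- The shadow of the sets preceding the larger cascade consists of sets preceding the smaller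
one. -/
lemma erase_lt_cascadeSet {p : ℕ} (hj : p + 1 ≤ c (p + 1))
    (hc : StrictMonoOn c (Set.Ico (p + 1) (p + 1 + n))) {U : Finset ℕ} (hU : #U = p + 1 + n)
    (h : toColex U < toColex (cascadeSet (p + 1) (p + 1) n c)) {u : ℕ} (hu : u ∈ U) :
    toColex (U.erase u) < toColex (cascadeSet p (p + 1) n c) := by
  induction n generalizing U with
  | zero =>
    rw [cascadeSet_zero] at h
    exact absurd h (not_lt_colex_range hU)
  | succ n ih =>
    rw [cascadeSet_succ, toColex_lt_insert_iff (lt_of_mem_cascadeSet le_rfl hj hc)] at h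
    rw [cascadeSet_succ, toColex_lt_insert_iff (lt_of_mem_cascadeSet (by omega) hj hc)]
    rcases h with h | ⟨h1, h2⟩
    · exact Or.inl fun x hx => h x (mem_of_mem_erase hx)
    by_cases hua : u = c (p + 1 + n)
    · subst hua
      exact Or.inl (forall_lt_mono h2.le (lt_of_mem_cascadeSet le_rfl hj hc))
    · refine Or.inr ⟨mem_erase.2 ⟨fun h => hua h.symm, h1⟩, ?_⟩
      rw [erase_right_comm]
      exact ih (hc.mono (Set.Ico_subset_Ico_right (by omega)))
        (by rw [card_erase_of_mem h1, hU]; omega) h2 (mem_erase.2 ⟨hua, hu⟩)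

end cascadeSet

/-- The colexicographic meaning of `a ↦ a^{(i)}`: `Z` is the `i`-set of rank `a` and `T` the
`(i + 1)`-set of rank `a^{(i)}`. The set `Z` arises from `T` by removing an element, so it does not
exceed the last set of the shadow of `T`, while everything in the shadow of a set before `T` comes
before `Z`. If `T` does not fit into `{0, …, M - 1}`, that set has at most `a^{(i)}` subsets of size
`i + 1`. -/
lemma exists_colex_of_pos {a i : ℕ} (hi : 1 ≤ i) (ha : 0 < a) :
    ∃ Z T : Finset ℕ, #Z = i ∧ #T = i + 1 ∧ colexRank Z = a ∧ colexRank T = macaulayShift a i ∧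
      (∃ q ∈ T, Z = T.erase q) ∧
      (∀ M, (∀ x ∈ T, x < M) ∨ M.choose (i + 1) ≤ macaulayShift a i) ∧
      ∀ U : Finset ℕ, #U = i + 1 → toColex U < toColex T → ∀ u ∈ U,
        toColex (U.erase u) < toColex Z := by
  obtain ⟨j, c, h⟩ := IsMacaulayExpansion.exists_of_pos hi ha
  have hj1 := h.one_le
  have hji := h.le
  obtain ⟨p, rfl⟩ : ∃ p, j = p + 1 := ⟨j - 1, by omega⟩
  obtain ⟨n, rfl⟩ : ∃ n, i = p + 1 + n := ⟨i - (p + 1), by omega⟩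
  have hIcc : Icc (p + 1) (p + 1 + n) = Ico (p + 1) (p + 1 + (n + 1)) := by
    ext; simp only [mem_Icc, mem_Ico]; omega
  have hc : StrictMonoOn c (Set.Ico (p + 1) (p + 1 + (n + 1))) :=
    h.strictMonoOn.mono fun x hx => ⟨hx.1, by have := hx.2; omega⟩
  have hlt := lt_of_mem_cascadeSet (b := p + 1) le_rfl h.le_last hc
  have hmax : cascadeSet (p + 1) (p + 1) (n + 1) c =
      insert p (cascadeSet p (p + 1) (n + 1) c) := by
    rw [cascadeSet, range_add_one, insert_union, cascadeSet]
  have hp : p ∉ cascadeSet p (p + 1) (n + 1) c := by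
    simp only [cascadeSet, mem_union, mem_range, lt_irrefl, false_or, mem_image, mem_Ico, not_exists,
      not_and]
    intro l hl
    have := hc.monotoneOn (a := p + 1) ⟨le_rfl, by omega⟩ ⟨hl.1, hl.2⟩ hl.1
    have := h.le_last
    omega
  -- The expansion starts at `j = p + 1`, and `Z` is `T` without its element `j - 1`.
  refine ⟨cascadeSet p (p + 1) (n + 1) c, cascadeSet (p + 1) (p + 1) (n + 1) c, ?_, ?_, ?_, ?_,
    ⟨p, ?_, ?_⟩, fun M => ?_, ?_⟩
  · rw [card_cascadeSet (by omega) h.le_last hc]; omega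
  · rw [card_cascadeSet le_rfl h.le_last hc]; omega
  · rw [colexRank_cascadeSet (e := 0) (by omega) rfl h.le_last hc, h.eq_sum, hIcc]
    rfl
  · rw [colexRank_cascadeSet (e := 1) le_rfl rfl h.le_last hc, h.macaulayShift_eq, hIcc]
  · rw [hmax]; exact mem_insert_self _ _
  · rw [hmax, erase_insert hp]
  · rcases Nat.lt_or_ge (c (p + 1 + n)) M with hM | hM
    · left
      intro x hx
      rw [cascadeSet_succ, mem_insert] at hx
      rcases hx with rfl | hx
      · exact hM
      · exact (hlt x hx).trans hM
    · right
      rw [h.macaulayShift_eq]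
      exact (Nat.choose_le_choose _ hM).trans
        (single_le_sum (f := fun l => (c l).choose (l + 1)) (fun _ _ => Nat.zero_le _)
          (mem_Icc.2 ⟨hji, le_rfl⟩))
  · intro U hU hUT u hu
    exact erase_lt_cascadeSet h.le_last hc (by omega) hUT hu

/-- The sets of size `d` and of colexicographic rank less than `a`: there are `a` of them. -/
lemma ncard_colexRank_lt {d : ℕ} (hd : 1 ≤ d) (a : ℕ) :
    {s : Finset ℕ | #s = d ∧ colexRank s < a}.ncard = a := by
  rcases Nat.eq_zero_or_pos a with rfl | ha
  · simp
  · obtain ⟨Z, T, hZ, -, hr, -⟩ := exists_colex_of_pos hd ha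
    have : {s : Finset ℕ | #s = d ∧ colexRank s < a} =
        {t : Finset ℕ | #t = #Z ∧ toColex t < toColex Z} := by
      ext s
      simp only [Set.mem_ofPred_eq, hZ]
      exact and_congr_right fun h => by rw [← hr, colexRank_lt_iff (h.trans hZ.symm)]
    rw [this]
    exact hr

lemma macaulayShift_pos {a i : ℕ} (h : 0 < macaulayShift a i) : 0 < a := by
  by_contra h0
  rw [Nat.eq_zero_of_not_pos h0, macaulayShift_zero] at h
  exact lt_irrefl _ h

/-- The numerical form of the Kruskal–Katona theorem: a family with more than `a^{(i)}` members a
shadow at least as large as that of the initial segment ending at the set of rank `a^{(i)}`, which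
has more than `a` members. -/
theorem card_le_macaulayShift {m i a : ℕ} (hi : 1 ≤ i) {𝒜 : Finset (Finset (Fin m))}
    (h𝒜 : (𝒜 : Set (Finset (Fin m))).Sized (i + 1)) (ha : #(∂ 𝒜) ≤ a) :
    #𝒜 ≤ macaulayShift a i := by
  rcases Nat.eq_zero_or_pos a with rfl | h0
  · have : 𝒜 = ∅ := by
      refine eq_empty_of_forall_notMem fun s hs => ?_
      obtain ⟨x, hx⟩ := card_pos.1 (by rw [h𝒜 hs]; omega : 0 < #s)
      have := erase_mem_shadow hs hx
      rw [card_eq_zero.1 (Nat.le_zero.1 ha)] at this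
      simp at this
    simp [this]
  obtain ⟨Z, T, hZ, hT, hrZ, hrT, ⟨q, hqT, hq⟩, hM, -⟩ := exists_colex_of_pos hi h0
  rcases hM m with hM | hM
  swap
  · refine le_trans ?_ hM
    have : 𝒜 ⊆ powersetCard (i + 1) univ := fun s hs => mem_powersetCard.2 ⟨subset_univ _, h𝒜 hs⟩
    simpa using card_le_card this
  by_contra! hlt
  set T' : Finset (Fin m) := T.attachFin hM
  -- The initial segment up to a set `S` has one element more than the rank of `S`.
  have hseg : ∀ S : Finset (Fin m), #(initSeg S) = colexRank (S.map Fin.valEmbedding) + 1 := by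
    intro S
    have hS : initSeg S = insert S ((initSeg S).erase S) := (insert_erase mem_initSeg_self).symm
    rw [hS, card_insert_of_notMem (notMem_erase _ _)]
    congr 1
    rw [colexRank, ← Set.ncard_coe_finset, ← Set.ncard_image_of_injective _
      (map_injective Fin.valEmbedding)]
    congr 1
    ext t
    have hmono : ∀ x : Finset (Fin m), toColex (x.map Fin.valEmbedding) <
        toColex (S.map Fin.valEmbedding) ↔ toColex x < toColex S := by
      intro x
      rw [map_eq_image, map_eq_image]
      exact toColex_image_lt_toColex_image Fin.val_strictMono
    simp only [coe_erase, Set.mem_image, Set.mem_sdiff, mem_coe, mem_initSeg, Set.mem_singleton_iff,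
      Set.mem_ofPred_eq, card_map]
    constructor
    · rintro ⟨x, ⟨⟨h1, h2⟩, h3⟩, rfl⟩
      refine ⟨by simp [h1], (hmono x).2 (lt_of_le_of_ne h2 fun h => h3 (toColex_inj.1 h))⟩
    · rintro ⟨h1, h2⟩
      have hbd : ∀ y ∈ t, y < m := forall_lt_mono h2.le (by simp)
      have ht : (t.attachFin hbd).map Fin.valEmbedding = t :=
        map_valEmbedding_attachFin hbd
      rw [← ht, hmono] at h2
      exact ⟨t.attachFin hbd, ⟨⟨by simp [h1], h2.le⟩, fun h => h2.ne (by rw [h])⟩, ht⟩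
  have hTT : T'.map Fin.valEmbedding = T :=
    map_valEmbedding_attachFin hM
  have hne : T'.Nonempty := by
    rw [← card_pos, card_attachFin, hT]; omega
  have hsz : #T' = i + 1 := by rw [card_attachFin, hT]
  have h1 := kruskal_katona h𝒜 (𝒞 := initSeg T') (by rw [hseg, hTT, hrT]; exact hlt)
    (hsz ▸ isInitSeg_initSeg)
  rw [shadow_initSeg hne, hseg] at h1
  have h2 : toColex Z ≤ toColex ((T'.erase (T'.min' hne)).map Fin.valEmbedding) := by
    have hq' : (⟨q, hM q hqT⟩ : Fin m) ∈ T' := mem_attachFin _ |>.2 hqT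
    have : Z = (T'.erase ⟨q, hM q hqT⟩).map Fin.valEmbedding := by
      rw [map_erase, hTT, hq]
      rfl
    rw [this, map_eq_image, map_eq_image]
    exact (toColex_image_le_toColex_image Fin.val_strictMono).2 (erase_le_erase_min' le_rfl le_rfl hq')
  have h3 : #Z = #((T'.erase (T'.min' hne)).map Fin.valEmbedding) := by
    rw [card_map, card_erase_of_mem (min'_mem _ _), hZ, hsz]
    rfl
  have h4 := not_lt.1 (mt (colexRank_lt_iff h3.symm).1 h2.not_gt)
  omega

/-- The rank conditions make the sets of rank less than `r` of their size into a simplicial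
complex. -/
lemma colexRank_erase_lt {r : ℕ → ℕ} (h0 : r 0 = 1)
    (hr : ∀ i, 1 ≤ i → r (i + 1) ≤ macaulayShift (r i) i) {s : Finset ℕ} {x : ℕ} (hx : x ∈ s)
    (hs : colexRank s < r #s) : colexRank (s.erase x) < r #(s.erase x) := by
  have hc := card_erase_add_one hx
  rcases Nat.eq_zero_or_pos #(s.erase x) with h | h
  · rw [card_eq_zero.1 h, ← range_zero, colexRank_range, card_range, h0]
    exact one_pos
  · have h1 := hr _ h
    rw [hc] at h1
    have h2 := hs.trans_le h1
    obtain ⟨Z, T, hZ, hT, hrZ, hrT, -, -, h'⟩ :=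
      exists_colex_of_pos h (macaulayShift_pos ((Nat.zero_le _).trans_lt h2))
    rw [← hrT, colexRank_lt_iff (by omega)] at h2
    have h3 := h' s (by omega) h2 x hx
    rwa [← colexRank_lt_iff hZ.symm, hrZ] at h3

/-- A face of that complex has all its vertices among the first `r 1 ≤ m`, since the rank of `{x}`
is `x`. -/
lemma lt_of_colexRank_lt {r : ℕ → ℕ} {m : ℕ} (h0 : r 0 = 1) (h1 : r 1 ≤ m)
    (hr : ∀ i, 1 ≤ i → r (i + 1) ≤ macaulayShift (r i) i) {s : Finset ℕ}
    (hs : colexRank s < r #s) : ∀ x ∈ s, x < m := by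
  intro x hx
  induction h : #s generalizing s with
  | zero => simp [card_eq_zero.1 h] at hx
  | succ n ih =>
    by_cases hy : ∃ y ∈ s, y ≠ x
    · obtain ⟨y, hy, hyx⟩ := hy
      exact ih (colexRank_erase_lt h0 hr hy hs) (mem_erase.2 ⟨hyx.symm, hx⟩)
        (by rw [card_erase_of_mem hy, h]; rfl)
    · push Not at hy
      obtain rfl : s = {x} := eq_singleton_iff_unique_mem.2 ⟨hx, hy⟩
      have : colexRank {x} = x := by
        rw [← insert_empty_eq, colexRank_insert (by simp), ← range_zero, colexRank_range]
        simp
      rw [this, card_singleton] at hs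
      omega

/-- A sequence satisfying the Kruskal–Katona conditions is the sequence of face numbers of a
simplicial complex on `m` vertices. -/
theorem exists_simplicialComplex {r : ℕ → ℕ} {m : ℕ} (h0 : r 0 = 1) (h1 : r 1 ≤ m)
    (hr : ∀ i, 1 ≤ i → r (i + 1) ≤ macaulayShift (r i) i) :
    ∃ Δ : Set (Finset (Fin m)), (∀ s ∈ Δ, ∀ x ∈ s, s.erase x ∈ Δ) ∧
      ∀ d, {s | s ∈ Δ ∧ #s = d}.ncard = r d := by
  refine ⟨{s | colexRank (s.map Fin.valEmbedding) < r #s}, fun s hs x hx => ?_, fun d => ?_⟩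
  · have := colexRank_erase_lt h0 hr (mem_map_of_mem Fin.valEmbedding hx) (by simpa using hs)
    rw [← map_erase, card_map] at this
    exact this
  · rw [← Set.ncard_image_of_injective _ (map_injective Fin.valEmbedding)]
    have : map Fin.valEmbedding '' {s : Finset (Fin m) |
        s ∈ {s | colexRank (s.map Fin.valEmbedding) < r #s} ∧ #s = d} =
        {s : Finset ℕ | #s = d ∧ colexRank s < r d} := by
      ext t
      simp only [Set.mem_ofPred_eq, Set.mem_image]
      constructor
      · rintro ⟨s, ⟨h, rfl⟩, rfl⟩
        exact ⟨card_map _, h⟩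
      · rintro ⟨rfl, h⟩
        have hbd := lt_of_colexRank_lt h0 h1 hr h
        have ht : (t.attachFin hbd).map Fin.valEmbedding = t :=
          map_valEmbedding_attachFin hbd
        exact ⟨t.attachFin hbd, ⟨by rw [ht, card_attachFin]; exact h, by simp⟩, ht⟩
    rw [this]
    rcases Nat.eq_zero_or_pos d with rfl | hd
    · have : {s : Finset ℕ | #s = 0 ∧ colexRank s < r 0} = {∅} := by
        ext s
        simp only [card_eq_zero, Set.mem_ofPred_eq, Set.mem_singleton_iff, and_iff_left_iff_imp]
        rintro rfl
        rw [← range_zero, colexRank_range, h0]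
        exact one_pos
      rw [this, Set.ncard_singleton, h0]
    · exact ncard_colexRank_lt hd _

end Colex

/-! ### Leading positions of a subspace -/

section Leading

variable {ι α K : Type*} [LinearOrder α] [Field K]

/-- The positions of the leading entries of the vectors in `V`, where `e` orders the positions and
the leading entry of a vector is its last nonzero one. -/
def leadingPositions (e : ι → α) (V : Submodule K (ι → K)) : Set ι :=
  {t | ∃ x ∈ V, x t ≠ 0 ∧ ∀ t', e t < e t' → x t' = 0}

lemma exists_mem_leadingPositions [Finite ι] {e : ι → α} {V : Submodule K (ι → K)} {x : ι → K}
    (hx : x ∈ V) (h0 : x ≠ 0) : ∃ t ∈ leadingPositions e V, x t ≠ 0 := by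
  obtain ⟨t, ht, hmax⟩ := Set.exists_max_image {t | x t ≠ 0} e (Set.toFinite _)
    (Function.ne_iff.1 h0)
  refine ⟨t, ⟨x, hx, ht, fun t' h => ?_⟩, ht⟩
  by_contra h'
  exact (hmax t' h').not_gt h

/-- Passing to leading positions preserves the dimension. -/
lemma ncard_leadingPositions [Finite ι] {e : ι → α} (he : Function.Injective e)
    (V : Submodule K (ι → K)) : (leadingPositions e V).ncard = Module.finrank K V := by
  have := Fintype.ofFinite ι
  have := Fintype.ofFinite (leadingPositions e V)
  rw [← Nat.card_coe_set_eq, Nat.card_eq_fintype_card]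
  apply le_antisymm
  · choose x hxV hx0 hxlt using fun t : leadingPositions e V => t.2
    have hli : LinearIndependent K fun t => (⟨x t, hxV t⟩ : V) := by
      rw [Fintype.linearIndependent_iff]
      intro g hg
      by_contra! hne
      -- The largest position with a nonzero coefficient cannot cancel.
      obtain ⟨t, ht, hmax⟩ := Set.exists_max_image {t | g t ≠ 0} (fun t => e t) (Set.toFinite _) hne
      have h1 := congrFun (congrArg Subtype.val hg) t
      simp only [Submodule.coe_sum, Submodule.coe_smul, Finset.sum_apply, Pi.smul_apply,
        smul_eq_mul, ZeroMemClass.coe_zero, Pi.zero_apply] at h1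
      rw [Finset.sum_eq_single t] at h1
      · exact mul_ne_zero ht (hx0 t) h1
      · intro s _ hst
        by_cases hs : g s = 0
        · rw [hs, zero_mul]
        · rw [hxlt s t (lt_of_le_of_ne (hmax s hs) fun h => hst (Subtype.ext (he h))), mul_zero]
      · simp
    exact hli.fintype_card_le_finrank
  · let φ : V →ₗ[K] (leadingPositions e V → K) :=
      LinearMap.pi fun t => LinearMap.proj t.1 ∘ₗ V.subtype
    have hφ : Function.Injective φ := by
      rw [injective_iff_map_eq_zero]
      intro x hx
      by_contra h0
      obtain ⟨t, ht, h⟩ := exists_mem_leadingPositions (e := e) x.2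
        (fun h => h0 (Subtype.ext h))
      exact h (congrFun hx ⟨t, ht⟩)
    simpa using LinearMap.finrank_le_finrank_of_injective hφ

end Leading

/-! ### Contractions on the exterior algebra -/

section Contraction

variable {A : Type*} [CommRing A] {m d : ℕ}

/-- The set `T` with a new element `i` added. -/
def KoszulIndex.insert (T : KoszulIndex m d) (i : Fin m) (h : i ∉ T.1) : KoszulIndex m (d + 1) :=
  ⟨Insert.insert i T.1, by rw [Finset.card_insert_of_notMem h, T.2]⟩

/-- Contraction with the `i`-th dual basis vector on the exterior power `Λ^(d+1) A^m`, in the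
coordinates given by the sets `T`, with the signs of the Koszul differential. -/
def contraction (i : Fin m) : (KoszulIndex m (d + 1) → A) →ₗ[A] (KoszulIndex m d → A) where
  toFun x T := if h : i ∈ T.1 then 0 else
    (-1) ^ koszulPos (insert i T.1) i * x (T.insert i h)
  map_add' x y := by
    ext T
    by_cases h : i ∈ T.1 <;> simp [h, mul_add]
  map_smul' c x := by
    ext T
    by_cases h : i ∈ T.1 <;> simp [h, mul_left_comm]

lemma contraction_of_mem {i : Fin m} {T : KoszulIndex m d} (h : i ∈ T.1)
    (x : KoszulIndex m (d + 1) → A) : contraction i x T = 0 := dif_pos h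

lemma contraction_of_notMem {i : Fin m} {T : KoszulIndex m d} (h : i ∉ T.1)
    (x : KoszulIndex m (d + 1) → A) :
    contraction i x T = (-1) ^ koszulPos (insert i T.1) i * x (T.insert i h) := dif_neg h

lemma contraction_comp {B : Type*} [CommRing B] (p : A →+* B) (i : Fin m)
    (x : KoszulIndex m (d + 1) → A) : contraction i (p ∘ x) = p ∘ contraction i x := by
  ext T
  by_cases h : i ∈ T.1
  · simp [contraction_of_mem h]
  · simp [contraction_of_notMem h]

lemma contraction_erase {T : KoszulIndex m (d + 1)} (i : {i // i ∈ T.1})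
    (x : KoszulIndex m (d + 1) → A) :
    contraction i.1 x (T.erase i) = (-1) ^ koszulPos T.1 i.1 * x T := by
  have h : i.1 ∉ (T.erase i).1 := Finset.notMem_erase _ _
  have h' : insert i.1 (T.erase i).1 = T.1 := Finset.insert_erase i.2
  rw [contraction_of_notMem h, h']
  congr 2
  exact Subtype.ext h'

/-- The Koszul differential is the combination of the contractions with coefficients `f i`. -/
lemma koszulDiff_apply {R : Type u} [CommRing R] (f : Fin m → R)
    (x : KoszulIndex m (d + 1) →₀ R) (T : KoszulIndex m d) :
    koszulDiff f d x T = ∑ i, contraction i x T * f i := by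
  classical
  induction x using Finsupp.induction_linear with
  | zero => simp
  | add x y hx hy => simp [hx, hy, add_mul, Finset.sum_add_distrib]
  | single U c =>
    rw [koszulDiff, Finsupp.linearCombination_single, Finsupp.smul_apply, Finsupp.finsetSum_apply,
      Finset.smul_sum]
    have hterm : ∀ i : {i // i ∈ U.1}, c • Finsupp.single (U.erase i)
        ((-1) ^ koszulPos U.1 i.1 * f i.1) T =
        (fun i => contraction i (Finsupp.single U c) T * f i) i.1 := by
      intro i
      dsimp only
      by_cases hT : U.erase i = T
      · subst hT
        rw [contraction_erase, Finsupp.single_eq_same, Finsupp.single_eq_same, smul_eq_mul]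
        ring
      · rw [Finsupp.single_eq_of_ne (Ne.symm hT), smul_zero]
        by_cases hi : i.1 ∈ T.1
        · rw [contraction_of_mem hi, zero_mul]
        · rw [contraction_of_notMem hi, Finsupp.single_eq_of_ne, mul_zero, zero_mul]
          rintro h
          exact hT (Subtype.ext ((congrArg (fun S => S.1.erase i.1) h.symm).trans
            (Finset.erase_insert hi)))
    rw [Finset.sum_congr rfl fun i _ => hterm i, Finset.sum_coe_sort U.1 fun i =>
      contraction i (Finsupp.single U c) T * f i]
    refine Finset.sum_subset (Finset.subset_univ _) fun i _ hi => ?_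
    by_cases hiT : i ∈ T.1
    · rw [contraction_of_mem hiT, zero_mul]
    · rw [contraction_of_notMem hiT, Finsupp.single_eq_of_ne, mul_zero, zero_mul]
      rintro rfl
      exact hi (Finset.mem_insert_self _ _)

end Contraction

/-! ### Subspaces closed under contractions -/

section ContractionClosed

open Finset Finset.Colex
open scoped FinsetFamily

variable {K : Type*} [Field K] {m : ℕ} {V : ∀ d, Submodule K (KoszulIndex m d → K)}

/-- The leading sets, for the colexicographic order, of a subspace of `Λ^d K^m`. -/
noncomputable def leadingSets {d : ℕ} (V : Submodule K (KoszulIndex m d → K)) :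
    Finset (Finset (Fin m)) :=
  (Set.toFinite (leadingPositions (fun T : KoszulIndex m d => toColex T.1) V)).toFinset.map
    (Function.Embedding.subtype _)

lemma card_leadingSets {d : ℕ} (V : Submodule K (KoszulIndex m d → K)) :
    #(leadingSets V) = Module.finrank K V := by
  rw [leadingSets, card_map, ← Set.ncard_eq_toFinset_card, ncard_leadingPositions]
  exact fun S T h => Subtype.ext (toColex_inj.1 h)

lemma mem_leadingSets {d : ℕ} {V : Submodule K (KoszulIndex m d → K)} {T : Finset (Fin m)} :
    T ∈ leadingSets V ↔ ∃ h : #T = d,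
      (⟨T, h⟩ : KoszulIndex m d) ∈ leadingPositions (fun T => toColex T.1) V := by
  simp [leadingSets]

lemma sized_leadingSets {d : ℕ} (V : Submodule K (KoszulIndex m d → K)) :
    (leadingSets V : Set (Finset (Fin m))).Sized d :=
  fun _ hT => (mem_leadingSets.1 hT).1

/-- Contraction with `i` sends a vector with leading set `T ∋ i` to one with leading set
`T \ {i}`. -/
lemma shadow_leadingSets_subset (hV : ∀ d i, ∀ x ∈ V (d + 1), contraction i x ∈ V d) (d : ℕ) :
    ∂ (leadingSets (V (d + 1))) ⊆ leadingSets (V d) := by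
  intro S hS
  obtain ⟨T, hT, i, hi, rfl⟩ := mem_shadow_iff.1 hS
  obtain ⟨hc, x, hx, hxT, hlt⟩ := mem_leadingSets.1 hT
  refine mem_leadingSets.2 ⟨by rw [card_erase_of_mem hi, hc]; rfl, contraction i x, hV d i x hx,
    ?_, ?_⟩
  · have h := contraction_erase (T := ⟨T, hc⟩) ⟨i, hi⟩ x
    exact h.symm ▸ mul_ne_zero (pow_ne_zero _ (by simp)) hxT
  · intro T' hT'
    by_cases h : i ∈ T'.1
    · exact contraction_of_mem h x
    · rw [contraction_of_notMem h, hlt, mul_zero]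
      have h1 : i ∈ insert i T'.1 := mem_insert_self _ _
      change toColex T < toColex (insert i T'.1)
      rw [← toColex_sdiff_lt_toColex_sdiff (u := {i}) (by simpa) (by simp),
        sdiff_singleton_eq_erase, sdiff_singleton_eq_erase, erase_insert h]
      exact hT'

/-- The Kruskal–Katona inequalities for quotients of the exterior algebra, in dual form: for a
graded subspace closed under all contractions. -/
theorem finrank_of_contraction_mem (hV : ∀ d i, ∀ x ∈ V (d + 1), contraction i x ∈ V d) :
    (∀ d, Module.finrank K (V d) = 0) ∨
      (Module.finrank K (V 0) = 1 ∧ Module.finrank K (V 1) ≤ m ∧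
        ∀ i, 1 ≤ i → Module.finrank K (V (i + 1)) ≤ macaulayShift (Module.finrank K (V i)) i) := by
  have hle : ∀ d, #(leadingSets (V d)) ≤ m.choose d := fun d => by
    have h : leadingSets (V d) ⊆ powersetCard d univ := fun s hs =>
      mem_powersetCard.2 ⟨subset_univ _, sized_leadingSets _ hs⟩
    simpa using card_le_card h
  simp only [← card_leadingSets]
  rcases Nat.eq_zero_or_pos #(leadingSets (V 0)) with h0 | h0
  · left
    intro d
    induction d with
    | zero => exact h0
    | succ d ih =>
      have h1 := shadow_leadingSets_subset hV d
      rw [card_eq_zero.1 ih, subset_empty] at h1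
      refine card_eq_zero.2 (eq_empty_of_forall_notMem fun s hs => ?_)
      obtain ⟨x, hx⟩ := card_pos.1 (by rw [sized_leadingSets _ hs]; omega : 0 < #s)
      have := erase_mem_shadow hs hx
      simp [h1] at this
  · right
    have h1 := hle 0
    have h2 := hle 1
    rw [Nat.choose_zero_right] at h1
    rw [Nat.choose_one_right] at h2
    exact ⟨by omega, h2, fun i hi => card_le_macaulayShift hi (sized_leadingSets _)
      (card_le_card (shadow_leadingSets_subset hV i))⟩

end ContractionClosed

/-! ### Reduction of subcomplexes modulo a maximal ideal -/

section Regular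

open RingTheory.Sequence

/-- The relations of a regular sequence have coefficients in the ideal it generates; this is the
vanishing of the first Koszul homology. -/
lemma mem_ofList_of_sum_mul_eq_zero {R : Type*} [CommRing R] {m : ℕ} (f : Fin m → R)
    (h : IsWeaklyRegular R (List.ofFn f)) (c : Fin m → R) (hc : ∑ i, c i * f i = 0) (i : Fin m) :
    c i ∈ Ideal.ofList (List.ofFn f) := by
  induction m with
  | zero => exact i.elim0
  | succ m ih =>
    rw [List.ofFn_succ', List.concat_eq_append] at h ⊢
    rw [isWeaklyRegular_append_iff, isWeaklyRegular_singleton_iff] at h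
    set J : Ideal R := Ideal.ofList (List.ofFn fun i : Fin m => f i.castSucc) with hJ
    obtain ⟨h1, h2⟩ := h
    rw [Fin.sum_univ_castSucc] at hc
    have hJr : J = Ideal.span (Set.range fun i : Fin m => f i.castSucc) := by
      rw [hJ, Ideal.ofList]
      congr 1
      ext; simp
    have hlast : c (Fin.last m) ∈ J := by
      have h3 : f (Fin.last m) • (Submodule.Quotient.mk (c (Fin.last m)) :
          R ⧸ (J • ⊤ : Submodule R R)) = 0 := by
        rw [← Submodule.Quotient.mk_smul, Submodule.Quotient.mk_eq_zero, Ideal.smul_eq_mul,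
          Ideal.mul_top, smul_eq_mul, mul_comm, eq_neg_of_add_eq_zero_right hc, hJr]
        exact neg_mem (sum_mem fun i _ => Ideal.mul_mem_left _ _ (Ideal.subset_span ⟨i, rfl⟩))
      have h4 := h2 (h3.trans (smul_zero _).symm)
      rwa [Submodule.Quotient.mk_eq_zero, Ideal.smul_eq_mul, Ideal.mul_top] at h4
    rw [Ideal.ofList_append]
    -- Write `c m` as a combination of the earlier `f j` and absorb it in the earlier coefficients.
    refine Fin.lastCases (Ideal.mem_sup_left hlast) (fun j => ?_) i
    obtain ⟨a, ha⟩ := Ideal.mem_span_range_iff_exists_fun.1 (hJr ▸ hlast)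
    have h5 := ih (fun i => f i.castSucc) h1 (fun i => c i.castSucc + a i * f (Fin.last m)) (by
      rw [← hc, ← ha, Finset.sum_mul, ← Finset.sum_add_distrib]
      exact Finset.sum_congr rfl fun i _ => by ring) j
    rw [← add_sub_cancel_right (c j.castSucc) (a j * f (Fin.last m))]
    exact sub_mem (Ideal.mem_sup_left h5)
      (Ideal.mem_sup_right (Ideal.mul_mem_left _ _ (by simp)))

end Regular

section Reduction

variable {R : Type*} [CommRing R] {K : Type*} [Field K] {M ι : Type*} [AddCommGroup M] [Module R M]

/-- The subspace of `K^ι` spanned by the reduction of the image of `φ : M → R^ι` along a ring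
homomorphism `p : R → K`. -/
def reducedRange (p : R →+* K) (φ : M →ₗ[R] (ι →₀ R)) : Submodule K (ι → K) :=
  Submodule.span K (Set.range fun y => p ∘ φ y)

lemma mem_reducedRange (p : R →+* K) (φ : M →ₗ[R] (ι →₀ R)) (y : M) :
    p ∘ φ y ∈ reducedRange p φ := Submodule.subset_span ⟨y, rfl⟩

/-- A split free submodule of rank `r` reduces to a subspace of dimension `r`. -/
lemma finrank_reducedRange [Finite ι] {p : R →+* K} (hp : Function.Surjective p)
    {φ : M →ₗ[R] (ι →₀ R)} {ψ : (ι →₀ R) →ₗ[R] M} (h : ψ ∘ₗ φ = LinearMap.id) {r : ℕ}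
    (b : Module.Basis (Fin r) R M) : Module.finrank K (reducedRange p φ) = r := by
  have hψ : ∀ y, ψ (φ y) = y := LinearMap.congr_fun h
  have hspan : reducedRange p φ = Submodule.span K (Set.range fun j => p ∘ φ (b j)) := by
    refine le_antisymm (Submodule.span_le.2 ?_) (Submodule.span_mono ?_)
    · rintro _ ⟨y, rfl⟩
      have : (p ∘ φ y) = ∑ j, p (b.repr y j) • (p ∘ φ (b j)) := by
        ext t
        conv_lhs => rw [← b.sum_repr y]
        simp only [map_sum, map_smul, Function.comp_apply, Finsupp.finsetSum_apply,
          Finsupp.smul_apply, smul_eq_mul, map_mul, Finset.sum_apply, Pi.smul_apply]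
      simp only [this]
      exact sum_mem fun j _ => Submodule.smul_mem _ _ (Submodule.subset_span ⟨j, rfl⟩)
    · rintro _ ⟨j, rfl⟩
      exact ⟨b j, rfl⟩
  rw [hspan, finrank_span_eq_card, Fintype.card_fin]
  rw [Fintype.linearIndependent_iff]
  intro g hg j
  choose a ha using fun j => hp (g j)
  have hker : ∀ t, φ (∑ j, a j • b j) t ∈ RingHom.ker p := by
    intro t
    have := congrFun hg t
    simpa [RingHom.mem_ker, ha] using this
  -- `ψ` maps vectors with entries in the kernel of `p` to such vectors.
  have hψker : ∀ x : ι →₀ R, (∀ t, x t ∈ RingHom.ker p) → p (b.repr (ψ x) j) = 0 := by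
    classical
    have := Fintype.ofFinite ι
    intro x hx
    conv_lhs => rw [← Finsupp.univ_sum_single x]
    rw [map_sum, map_sum, Finsupp.finsetSum_apply, map_sum]
    refine Finset.sum_eq_zero fun t _ => ?_
    rw [← mul_one (x t), ← smul_eq_mul, ← Finsupp.smul_single, map_smul, map_smul,
      Finsupp.smul_apply, smul_eq_mul, map_mul, (RingHom.mem_ker).1 (hx t), zero_mul]
  have := hψker _ hker
  rw [hψ] at this
  rwa [Module.Basis.repr_sum_self, ha] at this

end Reduction

/-- If `φ` embeds consecutive terms of a complex in the Koszul complex, the second embedding being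
split, then the reduced images are respected by the contractions: for `x` in the image of `φ'`, the
component of `∂ x = ∑ f i • contraction i x` complementary to the image of `φ` vanishes, so the
complementary component of each contraction has entries in the ideal of the `f i`. -/
lemma contraction_mem_reducedRange {R : Type u} [CommRing R] {K : Type*} [Field K] {m d : ℕ}
    {f : Fin m → R} {p : R →+* K}
    (hf : ∀ c : Fin m → R, ∑ i, c i * f i = 0 → ∀ i, p (c i) = 0)
    {M M' : Type*} [AddCommGroup M] [Module R M] [AddCommGroup M'] [Module R M']
    {φ : M →ₗ[R] (KoszulIndex m d →₀ R)} {φ' : M' →ₗ[R] (KoszulIndex m (d + 1) →₀ R)}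
    {ψ : (KoszulIndex m d →₀ R) →ₗ[R] M} (hψ : ψ ∘ₗ φ = LinearMap.id) (D : M' →ₗ[R] M)
    (hD : φ ∘ₗ D = koszulDiff f d ∘ₗ φ') (i : Fin m) :
    ∀ x ∈ reducedRange p φ', contraction i x ∈ reducedRange p φ := by
  classical
  change reducedRange p φ' ≤ (reducedRange p φ).comap (contraction i)
  refine Submodule.span_le.2 ?_
  rintro _ ⟨y, rfl⟩
  -- The contractions of `φ' y` as finitely supported functions.
  set w : Fin m → (KoszulIndex m d →₀ R) := fun i =>
    Finsupp.equivFunOnFinite.symm (contraction i (φ' y)) with hw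
  have hsum : koszulDiff f d (φ' y) = ∑ i, f i • w i := by
    ext T
    simp [koszulDiff_apply, hw, mul_comm]
  have h0 : koszulDiff f d (φ' y) - φ (ψ (koszulDiff f d (φ' y))) = 0 := by
    have h1 : koszulDiff f d (φ' y) = φ (D y) := (LinearMap.congr_fun hD y).symm
    have h2 : ψ (φ (D y)) = D y := LinearMap.congr_fun hψ _
    rw [h1, h2, sub_self]
  have h3 : ∀ T, p ((w i - φ (ψ (w i))) T) = 0 := by
    intro T
    refine hf (fun i => (w i - φ (ψ (w i))) T) ?_ i
    have := DFunLike.congr_fun h0 T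
    simp only [hsum, map_sum, map_smul, Finsupp.sub_apply, Finsupp.finsetSum_apply,
      Finsupp.smul_apply, smul_eq_mul, Finsupp.zero_apply] at this
    simpa only [Finsupp.sub_apply, mul_sub, Finset.sum_sub_distrib, mul_comm _ (f _)] using this
  have h4 : contraction i (p ∘ φ' y) = p ∘ φ (ψ (w i)) := by
    rw [contraction_comp]
    ext T
    have := h3 T
    rw [Finsupp.sub_apply, map_sub, sub_eq_zero] at this
    exact this
  simp only [Submodule.comap_coe, Set.mem_preimage, SetLike.mem_coe]
  rw [h4]
  exact mem_reducedRange p φ _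

/-! ### The subcomplex of a simplicial complex -/

lemma koszulComplex_d {R : Type u} [CommRing R] {m : ℕ} (f : Fin m → R) (d : ℕ) :
    (koszulComplex f).d (d + 1) d = ModuleCat.ofHom (koszulDiff f d) :=
  ChainComplex.of_d (fun d => ModuleCat.of R (KoszulIndex m d →₀ R))
    (fun d => ModuleCat.ofHom (koszulDiff f d)) d

section Faces

variable {R : Type u} [CommRing R] {m : ℕ} (f : Fin m → R) {Δ : Set (Finset (Fin m))}

/-- The submodule of `K_d` with basis the `e_T`, for `T` a `d`-element face of `Δ`. -/
noncomputable def faceModule (R : Type u) [CommRing R] (Δ : Set (Finset (Fin m))) (d : ℕ) :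
    Submodule R (KoszulIndex m d →₀ R) :=
  Finsupp.supported R R {T : KoszulIndex m d | T.1 ∈ Δ}

lemma koszulDiff_mem_faceModule (hΔ : ∀ s ∈ Δ, ∀ x ∈ s, s.erase x ∈ Δ) (d : ℕ)
    (x : KoszulIndex m (d + 1) →₀ R) (hx : x ∈ faceModule R Δ (d + 1)) :
    koszulDiff f d x ∈ faceModule R Δ d := by
  rw [koszulDiff, Finsupp.linearCombination_apply]
  refine Submodule.sum_mem _ fun T hT => Submodule.smul_mem _ _ (Submodule.sum_mem _ fun i _ =>
    Finsupp.single_mem_supported R _ ?_)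
  exact hΔ _ ((Finsupp.mem_supported R x).1 hx hT) _ i.2

/-- The subcomplex of the Koszul complex spanned by the faces of a simplicial complex `Δ`. -/
noncomputable def faceComplex (hΔ : ∀ s ∈ Δ, ∀ x ∈ s, s.erase x ∈ Δ) :
    ChainComplex (ModuleCat.{u} R) ℕ :=
  ChainComplex.of (fun d => ModuleCat.of R (faceModule R Δ d))
    (fun d => ModuleCat.ofHom ((koszulDiff f d).restrict (koszulDiff_mem_faceModule f hΔ d)))
    (fun d => by
      rw [← ModuleCat.ofHom_comp]
      refine congrArg ModuleCat.ofHom (LinearMap.ext fun x => Subtype.ext ?_)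
      exact LinearMap.congr_fun (koszulDiff_comp f d) x.1)

lemma faceComplex_d (hΔ : ∀ s ∈ Δ, ∀ x ∈ s, s.erase x ∈ Δ) (d : ℕ) :
    (faceComplex f hΔ).d (d + 1) d =
      ModuleCat.ofHom ((koszulDiff f d).restrict (koszulDiff_mem_faceModule f hΔ d)) :=
  ChainComplex.of_d (fun d => ModuleCat.of R (faceModule R Δ d))
    (fun d => ModuleCat.ofHom ((koszulDiff f d).restrict (koszulDiff_mem_faceModule f hΔ d))) d

lemma isSubcomplex_faceComplex (hΔ : ∀ s ∈ Δ, ∀ x ∈ s, s.erase x ∈ Δ) :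
    IsSubcomplex (faceComplex f hΔ) (koszulComplex f) := by
  classical
  refine ⟨ChainComplex.ofHom (fun d => ModuleCat.ofHom (faceModule R Δ d).subtype)
    fun d => ?_, fun d => ⟨Finsupp.restrictDom R R _, ?_⟩⟩
  · rw [koszulComplex_d, faceComplex_d]
    rfl
  · exact Finsupp.restrictDom_comp_subtype _

lemma hasRankSequence_faceComplex [Nontrivial R] (hΔ : ∀ s ∈ Δ, ∀ x ∈ s, s.erase x ∈ Δ) {r : ℕ → ℕ}
    (hr : ∀ d, {s | s ∈ Δ ∧ s.card = d}.ncard = r d) :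
    HasRankSequence (faceComplex f hΔ) r := by
  intro d
  let e : faceModule R Δ d ≃ₗ[R] ({T : KoszulIndex m d | T.1 ∈ Δ} →₀ R) :=
    Finsupp.supportedEquivFinsupp _
  change Module.Free R (faceModule R Δ d) ∧ Module.rank R (faceModule R Δ d) = _
  refine ⟨Module.Free.of_equiv e.symm, ?_⟩
  rw [e.rank_eq, rank_finsupp_self, ← hr d, ← Set.cast_ncard (Set.toFinite _), Cardinal.lift_natCast,
    ← Set.ncard_image_of_injective _ Subtype.val_injective]
  congr 2
  ext s
  simp only [Set.mem_image, Set.mem_ofPred_eq, Subtype.exists, exists_and_left, exists_prop,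
    exists_eq_right_right]

/-- The face numbers of a simplicial complex form a rank sequence of a subcomplex. -/
lemma mem_rankSequences_of_simplicialComplex [Nontrivial R]
    (hΔ : ∀ s ∈ Δ, ∀ x ∈ s, s.erase x ∈ Δ) {r : ℕ → ℕ}
    (hr : ∀ d, {s | s ∈ Δ ∧ s.card = d}.ncard = r d) :
    r ∈ rankSequences (koszulComplex f) :=
  ⟨faceComplex f hΔ, isSubcomplex_faceComplex f hΔ, hasRankSequence_faceComplex f hΔ hr⟩

end Faces

/-! ### Rank sequences -/

/-- The rank sequences of subcomplexes of the Koszul complex of a regular sequence satisfy the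
Kruskal–Katona inequalities: reduce modulo any maximal ideal containing the sequence. -/
lemma of_mem_rankSequences {R : Type u} [CommRing R] {m : ℕ} {f : Fin m → R}
    (hreg : RingTheory.Sequence.IsRegular R (List.ofFn f)) {r : ℕ → ℕ}
    (h : r ∈ rankSequences (koszulComplex f)) :
    (∀ i, r i = 0) ∨
      (r 0 = 1 ∧ r 1 ≤ m ∧ ∀ i, 1 ≤ i → r (i + 1) ≤ macaulayShift (r i) i) := by
  have hne : Ideal.ofList (List.ofFn f) ≠ ⊤ := fun h => hreg.top_ne_smul (by
    rw [h, Ideal.smul_eq_mul, Ideal.mul_top])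
  obtain ⟨𝔪, h𝔪, hle⟩ := Ideal.exists_le_maximal _ hne
  have := Ideal.Quotient.nontrivial_iff.2 h𝔪.ne_top
  have : Nontrivial R := (Ideal.Quotient.mk 𝔪).domain_nontrivial
  let : Field (R ⧸ 𝔪) := Ideal.Quotient.field 𝔪
  have hf : ∀ c : Fin m → R, ∑ i, c i * f i = 0 → ∀ i, Ideal.Quotient.mk 𝔪 (c i) = 0 :=
    fun c hc i => Ideal.Quotient.eq_zero_iff_mem.2
      (hle (mem_ofList_of_sum_mul_eq_zero f hreg.toIsWeaklyRegular c hc i))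
  obtain ⟨F, ⟨φ, hφ⟩, hF⟩ := h
  choose ψ hψ using hφ
  let φ' : ∀ d, F.X d →ₗ[R] (KoszulIndex m d →₀ R) := fun d => (φ.f d).hom
  have hrank : ∀ d, Module.finrank (R ⧸ 𝔪) (reducedRange (Ideal.Quotient.mk 𝔪) (φ' d)) = r d := by
    intro d
    have := (hF d).1
    have hr : Module.finrank R (F.X d) = r d := Module.finrank_eq_of_rank_eq (hF d).2
    have : Module.Finite R (F.X d) :=
      Module.rank_lt_aleph0_iff.1 ((hF d).2 ▸ Cardinal.natCast_lt_aleph0)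
    exact finrank_reducedRange Ideal.Quotient.mk_surjective (hψ d)
      (Module.finBasisOfFinrankEq R (F.X d) hr)
  have hV : ∀ d i, ∀ x ∈ reducedRange (Ideal.Quotient.mk 𝔪) (φ' (d + 1)),
      contraction i x ∈ reducedRange (Ideal.Quotient.mk 𝔪) (φ' d) := by
    intro d i
    refine contraction_mem_reducedRange hf (hψ d) (F.d (d + 1) d).hom ?_ i
    have h1 := φ.comm (d + 1) d
    have h2 : (koszulComplex f).d (d + 1) d = ModuleCat.ofHom (koszulDiff f d) :=
      koszulComplex_d f d
    rw [h2] at h1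
    exact (congrArg ModuleCat.Hom.hom h1).symm
  simpa only [hrank] using finrank_of_contraction_mem
    (V := fun d => reducedRange (Ideal.Quotient.mk 𝔪) (φ' d)) hV

theorem theorem3 {k : Type u} [Field k] (n m : ℕ) (f : Fin m → MvPolynomial (Fin n) k)
    (hhom : ∀ i, ∃ d : ℕ, (f i).IsHomogeneous d)
    (hreg : RingTheory.Sequence.IsRegular (MvPolynomial (Fin n) k) (List.ofFn f))
    (r : ℕ → ℕ) (hr : ∀ i, m < i → r i = 0) :
    r ∈ rankSequences (koszulComplex f) ↔
      (∀ i, r i = 0) ∨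
        (r 0 = 1 ∧ r 1 ≤ m ∧
          ∀ i, 1 ≤ i → i + 1 ≤ m → r (i + 1) ≤ macaulayShift (r i) i) := by
  constructor
  · intro h
    exact (of_mem_rankSequences hreg h).imp_right fun h => ⟨h.1, h.2.1, fun i hi _ => h.2.2 i hi⟩
  · rintro (h | ⟨h0, h1, h⟩)
    · exact mem_rankSequences_of_simplicialComplex f (Δ := ∅) (by simp) (by simp [h])
    · obtain ⟨Δ, hΔ, hΔr⟩ := exists_simplicialComplex h0 h1 (fun i hi => by
        rcases Nat.lt_or_ge m (i + 1) with him | him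
        · rw [hr _ him]
          exact Nat.zero_le _
        · exact h i hi him)
      exact mem_rankSequences_of_simplicialComplex f hΔ hΔr
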